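/- Equip $\mathbb{R}^{d+1}=\mathbb{R}\times\mathbb{R}^d$ with the norm $\|(a,v)\|^2=a^2+\|v\|^2$. A function $f\colon\mathbb{R}^d\to\mathbb{R}$ is called piecewise affine if there are finitely many polyhedral sets $Q_1,\dots,Q_k$ (finite intersections of closed halfspaces) with nonempty, mutually disjoint interiors and with $\bigcup_i Q_i=\mathbb{R}^d$, such that $f$ is affine on each $Q_i$. Let $f\colon\mathbb{R}^d\to\mathbb{R}$ be piecewise affine and bounded below. Then $f$ attains a global minimum, and there exist finite nonempty families $(a_i,v_i)_{i\in I}$, $(b_j,w_j)_{j\in J}$ in $\mathbb{R}^{d+1}$ such that $$f(x)=\underline f(x)+\overline f(x),\qquad \underline f(x)=\max_{i\in I}(a_i+\langle v_i,x\rangle),\quad \overline f(x)=\min_{j\in J}(b_j+\langle w_j,x\rangle)\qquad\forall x\in\mathbb{R}^d.$$ For any such representation put $$\underline d f(x)=\mathrm{co}\{(a_i-\underline f(x)+\langle v_i,x\rangle,\,v_i) : i\in I\},\qquad z_j(x)=(b_j-\overline f(x)+\langle w_j,x\rangle,\,w_j),$$ and let $(a_j(x),v_j(x))$ be the element of least norm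 of $\underline d f(x)+z_j(x)$, $j\in J$. Then the following holds. (1) Let $\{x_n\}_{n\ge 0}$ be any sequence such that for all $n$ one has $f(x_{n+1})\le f(x_n)$ and $$f(x_{n+1})\le f\Big(x_n+\frac1{a_j(x_n)}v_j(x_n)\Big)\qquad\text{for every } j\in J \text{ with } a_j(x_n)<0.$$ Then there is $N$ such that for all $n\ge N$ one has $a_j(x_n)\ge 0$ for all $j\in J$, and $x_n$ is a global minimizer of $f$. (2) Consider the method of codifferential descent with $\mu=+\infty$ and with $\{z_j(x) : j\in J\}$ as its set of hyperdifferential points: given $x_n$, for each $z\in\{z_j(x_n) : j\in J\}$ let $(a_n(z),v_n(z))$ be the element of least norm of $\underline d f(x_n)+z$, let $\alpha_n(z)\ge 0$ minimize $\alpha\mapsto f(x_n-\alpha v_n(z))$ over $\alpha\ge 0$, let $z_n$ minimize $f(x_n-\alpha_n(z)v_n(z))$ over $z\in\{z_j(x_n) : j\in J\}$, and set $x_{n+1}=x_n-\alpha_n(z_n)v_n(z_n)$. For every starting point $x_0$ the method generates a sequence (all the minima involved are attained), and for every sequence $\{x_n\}$ generated by it there is $N$ such that for all $n\ge N$ one has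 $a_j(x_n)\ge0$ for all $j\in J$, and $x_n$ is a global minimizer of $f$. -/

import Mathlib

namespace PiecewiseAffine

open Set

/-- The space `ℝ^d` with its Euclidean norm. -/
abbrev E (d : ℕ) : Type := EuclideanSpace ℝ (Fin d)

/-- The space `ℝ × ℝ^d = ℝ^{d+1}` of pairs `(a, v)` with `‖(a, v)‖² = a² + ‖v‖²`. -/
abbrev EPlus (d : ℕ) : Type := WithLp 2 (ℝ × E d)

/-- The pair `(a, v)` as an element of `ℝ^{d+1}`. -/
abbrev pair {d : ℕ} (a : ℝ) (v : E d) : EPlus d := WithLp.toLp 2 (a, v)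

/-! ### Piecewise affine functions -/

/-- A polyhedral set: the intersection of a finite family of closed halfspaces. -/
def IsPolyhedral {d : ℕ} (Q : Set (E d)) : Prop :=
  ∃ (m : ℕ) (u : Fin m → E d) (c : Fin m → ℝ),
    (∀ i, u i ≠ 0) ∧ Q = {x | ∀ i, inner ℝ (u i) x ≤ c i}

/-- A polyhedral partition of `ℝ^d`: finitely many polyhedral sets with nonempty, mutually disjoint
interiors that cover the space. -/
structure IsPolyhedralPartition {d k : ℕ} (Q : Fin k → Set (E d)) : Prop where
  polyhedral : ∀ i, IsPolyhedral (Q i)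
  cover : (⋃ i, Q i) = univ
  interior_nonempty : ∀ i, (interior (Q i)).Nonempty
  interior_disjoint : ∀ i j, i ≠ j → Disjoint (interior (Q i)) (interior (Q j))

/-- `f` is piecewise affine: it is affine on each member of some polyhedral partition. -/
def IsPiecewiseAffine {d : ℕ} (f : E d → ℝ) : Prop :=
  ∃ (k : ℕ) (Q : Fin k → Set (E d)), IsPolyhedralPartition Q ∧
    ∀ i, ∃ g : E d →ᵃ[ℝ] ℝ, EqOn f g (Q i)

/-! ### DC decompositions and global codifferentials -/

/-- The coefficients `(a_i, v_i)`, `i ∈ I`, and `(b_j, w_j)`, `j ∈ J`, of a function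
`x ↦ max_i (a_i + ⟨v_i, x⟩) + min_j (b_j + ⟨w_j, x⟩)`, with finite nonempty `I` and `J`. -/
structure DCData (d : ℕ) where
  l : ℕ
  s : ℕ
  l_pos : 0 < l
  s_pos : 0 < s
  a : Fin l → ℝ
  v : Fin l → E d
  b : Fin s → ℝ
  w : Fin s → E d

namespace DCData

variable {d : ℕ} (D : DCData d)

theorem univ_nonempty_I : (Finset.univ : Finset (Fin D.l)).Nonempty := ⟨⟨0, D.l_pos⟩, by simp⟩

theorem univ_nonempty_J : (Finset.univ : Finset (Fin D.s)).Nonempty := ⟨⟨0, D.s_pos⟩, by simp⟩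

/-- The convex part `max_i (a_i + ⟨v_i, x⟩)`. -/
noncomputable def convexPart (x : E d) : ℝ :=
  Finset.univ.sup' D.univ_nonempty_I fun i => D.a i + inner ℝ (D.v i) x

/-- The concave part `min_j (b_j + ⟨w_j, x⟩)`. -/
noncomputable def concavePart (x : E d) : ℝ :=
  Finset.univ.inf' D.univ_nonempty_J fun j => D.b j + inner ℝ (D.w j) x

/-- `D` is a DC decomposition of `f`. -/
def Represents (f : E d → ℝ) : Prop :=
  ∀ x, f x = D.convexPart x + D.concavePart x

/-- The global hypodifferential at `x`. -/
noncomputable def hypodiff (x : E d) : Set (EPlus d) :=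
  convexHull ℝ (range fun i => pair (D.a i - D.convexPart x + inner ℝ (D.v i) x) (D.v i))

/-- The generators `z_j(x)` of the global hyperdifferential at `x`. -/
noncomputable def z (j : Fin D.s) (x : E d) : EPlus d :=
  pair (D.b j - D.concavePart x + inner ℝ (D.w j) x) (D.w j)

end DCData

/-- The translate `C + z`. -/
def translate {d : ℕ} (C : Set (EPlus d)) (z : EPlus d) : Set (EPlus d) := (fun p => p + z) '' C

/-- `p` is an element of `C` of least norm. -/
def IsLeastNorm {d : ℕ} (C : Set (EPlus d)) (p : EPlus d) : Prop :=
  p ∈ C ∧ ∀ q ∈ C, ‖p‖ ≤ ‖q‖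

namespace DCData

variable {d : ℕ} (D : DCData d)

theorem exists_isLeastNorm (j : Fin D.s) (x : E d) :
    ∃ p, IsLeastNorm (translate (D.hypodiff x) (D.z j x)) p := by
  have hc : IsCompact (translate (D.hypodiff x) (D.z j x)) :=
    ((Set.finite_range _).isCompact_convexHull (𝕜 := ℝ)).image
      (continuous_id.add continuous_const)
  have hne : (translate (D.hypodiff x) (D.z j x)).Nonempty :=
    Set.Nonempty.image _ ⟨_, subset_convexHull ℝ _ ⟨⟨0, D.l_pos⟩, rfl⟩⟩
  obtain ⟨p, hp, hmin⟩ := hc.exists_isMinOn hne continuous_norm.continuousOn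
  exact ⟨p, hp, fun q hq => hmin hq⟩

/-- The pair `(a_j(x), v_j(x))`: the element of least norm of `hypodiff x + z_j(x)`. -/
noncomputable def nearest (j : Fin D.s) (x : E d) : EPlus d :=
  Classical.choose (D.exists_isLeastNorm j x)

theorem nearest_isLeastNorm (j : Fin D.s) (x : E d) :
    IsLeastNorm (translate (D.hypodiff x) (D.z j x)) (D.nearest j x) :=
  Classical.choose_spec (D.exists_isLeastNorm j x)

/-- The element of least norm is unique, so `nearest` does not depend on any choice. -/
theorem eq_nearest (j : Fin D.s) (x : E d) (p : EPlus d)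
    (hp : IsLeastNorm (translate (D.hypodiff x) (D.z j x)) p) : p = D.nearest j x := by
  by_contra hne
  have hq := D.nearest_isLeastNorm j x
  have hconv : Convex ℝ (translate (D.hypodiff x) (D.z j x)) := by
    have h := (convex_convexHull ℝ (range fun i =>
      pair (D.a i - D.convexPart x + inner ℝ (D.v i) x) (D.v i))).translate (D.z j x)
    have e : translate (D.hypodiff x) (D.z j x) = (fun p => D.z j x + p) '' D.hypodiff x := by
      unfold translate
      congr 1
      funext p
      exact add_comm _ _
    rw [e]
    exact h
  have hm := hconv hp.1 hq.1 (by norm_num : (0 : ℝ) ≤ 1 / 2) (by norm_num : (0 : ℝ) ≤ 1 / 2)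
    (by norm_num)
  have hlt := norm_combo_lt_of_ne (hp.2 _ hq.1) le_rfl hne (by norm_num : (0 : ℝ) < 1 / 2)
    (by norm_num : (0 : ℝ) < 1 / 2) (by norm_num)
  exact absurd (hq.2 _ hm) (not_le.mpr hlt)

/-- The scalar `a_j(x)`. -/
noncomputable def aj (j : Fin D.s) (x : E d) : ℝ := (D.nearest j x).fst

/-- The vector `v_j(x)`. -/
noncomputable def vj (j : Fin D.s) (x : E d) : E d := (D.nearest j x).snd

end DCData

/-! ### The method of codifferential descent -/

/-- One iteration `x ↦ y` of the method of codifferential descent for `f`, with the hypodifferential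
`C` and the set `G` of hyperdifferential points at `x`, and the parameter `μ ∈ [0, +∞]`:
`p z = (a(z), v(z))` is the least norm element of `C + z`, `α z` is the step of the exact line search
from `x` along `-v(z)`, and `y` is the best of the points so obtained over all `z = (b, w) ∈ G`
with `b ≤ μ`. -/
def IsMCDStep {d : ℕ} (f : E d → ℝ) (C G : Set (EPlus d)) (μ : EReal) (x y : E d) : Prop :=
  ∃ (p : EPlus d → EPlus d) (α : EPlus d → ℝ),
    (∀ z ∈ G, (z.fst : EReal) ≤ μ → IsLeastNorm (translate C z) (p z)) ∧
    (∀ z ∈ G, (z.fst : EReal) ≤ μ → 0 ≤ α z ∧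
      ∀ β : ℝ, 0 ≤ β → f (x - α z • (p z).snd) ≤ f (x - β • (p z).snd)) ∧
    ∃ z₀ ∈ G, (z₀.fst : EReal) ≤ μ ∧
      (∀ z ∈ G, (z.fst : EReal) ≤ μ → f (x - α z₀ • (p z₀).snd) ≤ f (x - α z • (p z).snd)) ∧
      y = x - α z₀ • (p z₀).snd

/-- `x` is a sequence generated by the method of codifferential descent with `μ = +∞`, applied to
`f` with the hypodifferential `D.hypodiff` and the hyperdifferential points `z_j`. -/
def IsMCDSequence {d : ℕ} (f : E d → ℝ) (D : DCData d) (x : ℕ → E d) : Prop :=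
  ∀ n, IsMCDStep f (D.hypodiff (x n)) (range fun j => D.z j (x n)) ⊤ (x n) (x (n + 1))

/-- From some index on, `x n` passes the stopping test (`a_j(x n) ≥ 0` for all `j`) and is a global
minimizer of `f`. -/
def FindsGlobalMinimizer {d : ℕ} (f : E d → ℝ) (D : DCData d) (x : ℕ → E d) : Prop :=
  ∃ N : ℕ, ∀ n, N ≤ n → (∀ j, 0 ≤ D.aj j (x n)) ∧ ∀ y, f (x n) ≤ f y

end PiecewiseAffine

/-!
A continuous function made of finitely many affine pieces has, for any points `a` and `b`, a piece
lying below it at `a` and above it at `b`. As in the Kakutani–Stone theorem, it is therefore a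
lattice polynomial in its pieces, and the differences of maxima of affine functions form a lattice.

Write `f = min_j g_j` with `g_j` a maximum of affine functions. The set `C = hypodiff x + z_j(x)`
is the codifferential of `g_j`: `g_j(x + y) - f x` is the maximum over `C` of `⟪(1, y), ·⟫`. Let
`p = (a, v)` be its element of least norm, so that `⟪p, q⟫ ≥ ‖p‖²` on `C`. If `a < 0`, then
`(1, a⁻¹ v) = a⁻¹ p`, so the step `y = a⁻¹ v` brings `g_j` down to exactly `f x + a⁻¹ ‖p‖²`. Now `p`
lies in the face of `C` on which `⟪p, ·⟫ = ‖p‖²`. If this face contains some `(b, 0)`, then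
`b = a⁻¹ ‖p‖²` and the step minimizes `g_j`, which can happen only once for each `j`. Otherwise `v`
is in one of the finitely many hulls of slopes of `g_j` that miss the origin, and the decrease
`-a⁻¹ ‖p‖² ≥ ‖v‖` is bounded away from `0`. Hence eventually all `a_j(x_n) ≥ 0`, and then each `g_j`
is at least `f(x_n)` everywhere: `g_j` is bounded below, so `C` meets the axis `v = 0`, at a point
of nonnegative height.
-/

namespace PiecewiseAffine

open Set Filter Topology
open scoped Pointwise

section Selection

variable {X Y ι : Type*}

/-- `f` is a selection of the family `g`: at every point it takes the value of one of the `g i`,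
which are called the pieces of `f`. -/
def IsSelection (f : X → Y) (g : ι → X → Y) : Prop :=
  ∀ x, ∃ i, f x = g i x

variable [TopologicalSpace X] [TopologicalSpace Y] [T2Space Y] [Finite ι]
  {f : X → Y} {g : ι → X → Y}

theorem IsSelection.exists_eq_and_frequently_eq (hsel : IsSelection f g) (hf : Continuous f)
    (hg : ∀ i, Continuous (g i)) {x : X} {l : Filter X} [l.NeBot] (hl : l ≤ 𝓝 x) :
    ∃ i, f x = g i x ∧ ∃ᶠ y in l, f y = g i y := by
  obtain ⟨i, hi⟩ := frequently_exists.1 (Frequently.of_forall hsel : ∃ᶠ y in l, ∃ i, f y = g i y)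
  exact ⟨i, (isClosed_eq hf (hg i)).mem_of_frequently_of_tendsto hi hl, hi⟩

theorem IsSelection.isClosedMap (hsel : IsSelection f g) (hf : Continuous f)
    (hg : ∀ i, Continuous (g i)) (hclosed : ∀ i, IsClosedMap (g i)) : IsClosedMap f := by
  intro s hs
  have himage : f '' s = ⋃ i, g i '' (s ∩ {x | f x = g i x}) := by
    ext y
    simp only [mem_image, mem_iUnion, mem_inter_iff, mem_ofPred_eq]
    constructor
    · rintro ⟨x, hx, rfl⟩
      obtain ⟨i, hi⟩ := hsel x
      exact ⟨i, x, ⟨hx, hi⟩, hi.symm⟩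
    · rintro ⟨i, x, ⟨hx, hi⟩, rfl⟩
      exact ⟨x, hx, hi⟩
  rw [himage]
  exact isClosed_iUnion_of_finite fun i => hclosed i _ (hs.inter (isClosed_eq hf (hg i)))

end Selection

section AffineSelection

variable {ι : Type*} [Finite ι]

-- Otherwise some line through `(0, φ 0)` lies below `(1, φ 1)` and is met by pieces of smaller
-- slope only, so that `φ` can never cross it upwards.
theorem IsSelection.exists_affine_le_ge {φ : ℝ → ℝ} {p q : ι → ℝ}
    (hsel : IsSelection φ fun i t => p i + t * q i) (hφ : Continuous φ) :
    ∃ i, p i ≤ φ 0 ∧ φ 1 ≤ p i + q i := by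
  by_contra! h
  obtain ⟨m, hm, hmlt⟩ : ∃ m, (∀ i, p i ≤ φ 0 → p i + q i < φ 0 + m) ∧ m < φ 1 - φ 0 := by
    have hm : ∀ᶠ m in 𝓝[<] (φ 1 - φ 0), ∀ i, p i ≤ φ 0 → p i + q i < φ 0 + m := by
      refine eventually_all.2 fun i => eventually_imp_distrib_left.2 fun hi => ?_
      have hlt : p i + q i - φ 0 < φ 1 - φ 0 := sub_lt_sub_right (h i hi) _
      filter_upwards [Ioo_mem_nhdsLT hlt] with m hm
      linarith [hm.1]
    exact (hm.and self_mem_nhdsWithin).exists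
  choose i hi hfreq using fun c => hsel.exists_eq_and_frequently_eq hφ (fun i => by fun_prop)
    (nhdsWithin_le_nhds : 𝓝[>] c ≤ 𝓝 c)
  have hslope : ∀ c ∈ Ico (0 : ℝ) 1, φ c = φ 0 + c * m → q (i c) < m := by
    rintro c ⟨hc0, hc1⟩ hc
    have hline : p (i c) + c * q (i c) = φ 0 + c * m := (hi c).symm.trans hc
    rcases le_or_gt (p (i c)) (φ 0) with hle | hgt
    · nlinarith [hm _ hle]
    · nlinarith
  have hbelow : φ 1 ≤ φ 0 + 1 * m := by
    refine image_le_of_liminf_slope_right_lt_deriv_boundary (f' := fun c => q (i c))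
      hφ.continuousOn (fun c _ r hr => ?_) (by simp)
      (fun t => ((hasDerivAt_id t).mul_const m).const_add (φ 0))
      (fun c hc hcm => (hslope c hc hcm).trans_eq (one_mul m).symm) (right_mem_Icc.2 zero_le_one)
    refine ((hfreq c).and_eventually self_mem_nhdsWithin).mono fun z ⟨hz, hcz⟩ => ?_
    have hslope_eq : slope φ c z = q (i c) := by
      rw [slope_def_field, div_eq_iff (sub_pos.2 hcz).ne', hz, hi c]
      ring
    rwa [hslope_eq]
  linarith

theorem IsSelection.exists_affineMap_le_ge {V : Type*} [AddCommGroup V] [Module ℝ V]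
    [TopologicalSpace V] [IsTopologicalAddGroup V] [ContinuousSMul ℝ V] {f : V → ℝ}
    {g : ι → V →ᵃ[ℝ] ℝ} (hsel : IsSelection f fun i => g i) (hf : Continuous f) (a b : V) :
    ∃ i, g i a ≤ f a ∧ f b ≤ g i b := by
  have hline : IsSelection (f ∘ AffineMap.lineMap a b)
      fun i (t : ℝ) => g i a + t * (g i b - g i a) := by
    intro t
    obtain ⟨i, hi⟩ := hsel (AffineMap.lineMap a b t)
    refine ⟨i, ?_⟩
    simp only [Function.comp_apply, hi, AffineMap.apply_lineMap, AffineMap.lineMap_apply_ring']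
    ring
  simpa using hline.exists_affine_le_ge (hf.comp AffineMap.lineMap_continuous)

theorem IsSelection.exists_isMinOn_of_affine {φ : ℝ → ℝ} {p q : ι → ℝ}
    (hsel : IsSelection φ fun i t => p i + t * q i) (hφ : Continuous φ) {s : Set ℝ}
    (hs : IsClosed s) (hne : s.Nonempty) (hb : BddBelow (φ '' s)) : ∃ t ∈ s, IsMinOn φ s t := by
  have hclosed : IsClosedMap φ := hsel.isClosedMap hφ (fun i => by fun_prop) fun i =>
    (Homeomorph.addLeft (p i)).isClosedMap.comp (isClosedMap_smul_left (q i))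
  obtain ⟨t, ht, htmin⟩ := (hclosed s hs).csInf_mem (hne.image φ) hb
  exact ⟨t, ht, fun y hy => htmin.trans_le (csInf_le hb (mem_image_of_mem φ hy))⟩

end AffineSelection

section LatticeClosure

theorem mem_of_forall_exists_le_ge {X α : Type*} [Nonempty X] [Lattice α] {L : Set (X → α)}
    (hL : IsSublattice L) (hfin : L.Finite) {f : X → α}
    (hf : ∀ a b, ∃ g ∈ L, g a ≤ f a ∧ f b ≤ g b) : f ∈ L := by
  classical
  lift L to Finset (X → α) using hfin
  have hmajorant : ∀ a, ∃ h ∈ L, f ≤ h ∧ h a ≤ f a := by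
    intro a
    obtain ⟨g₀, hg₀, hg₀a, -⟩ := hf a a
    have hne : (L.filter fun g => g a ≤ f a).Nonempty := ⟨g₀, Finset.mem_filter.2 ⟨hg₀, hg₀a⟩⟩
    refine ⟨_, hL.1.finsetSup'_mem hne fun g hg => (Finset.mem_filter.1 hg).1, fun b => ?_, ?_⟩
    · obtain ⟨g, hg, hga, hgb⟩ := hf a b
      exact hgb.trans (Finset.le_sup' id (Finset.mem_filter.2 ⟨hg, hga⟩) b)
    · rw [Finset.sup'_apply]
      exact Finset.sup'_le _ _ fun g hg => (Finset.mem_filter.1 hg).2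
  have hne : (L.filter fun h => f ≤ h).Nonempty := by
    obtain ⟨h, hh, hfh, -⟩ := hmajorant (Classical.arbitrary X)
    exact ⟨h, Finset.mem_filter.2 ⟨hh, hfh⟩⟩
  have heq : f = (L.filter fun h => f ≤ h).inf' hne id := by
    refine le_antisymm (Finset.le_inf' _ _ fun h hh => (Finset.mem_filter.1 hh).2) fun a => ?_
    obtain ⟨h, hh, hfh, ha⟩ := hmajorant a
    exact (Finset.inf'_le id (Finset.mem_filter.2 ⟨hh, hfh⟩) a).trans ha
  rw [heq]
  exact hL.2.finsetInf'_mem hne fun h hh => (Finset.mem_filter.1 hh).1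

theorem IsSelection.mem_latticeClosure {ι V : Type*} [Finite ι] [AddCommGroup V] [Module ℝ V]
    [TopologicalSpace V] [IsTopologicalAddGroup V] [ContinuousSMul ℝ V] {f : V → ℝ}
    {g : ι → V →ᵃ[ℝ] ℝ} (hsel : IsSelection f fun i => g i) (hf : Continuous f) :
    f ∈ latticeClosure (range fun i => (g i : V → ℝ)) := by
  refine mem_of_forall_exists_le_ge isSublattice_latticeClosure (finite_range _).latticeClosure
    fun a b => ?_
  obtain ⟨i, hi⟩ := hsel.exists_affineMap_le_ge hf a b
  exact ⟨g i, subset_latticeClosure ⟨i, rfl⟩, hi⟩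

variable {α : Type*} [Lattice α] [AddCommGroup α] [AddLeftMono α] {s M : Set α}

theorem supClosure_add_subset (hs : s + s ⊆ s) :
    supClosure s + supClosure s ⊆ supClosure s := by
  have hleft : ∀ a ∈ s, ∀ b ∈ supClosure s, a + b ∈ supClosure s := fun a ha =>
    supClosure_min (t := {b | a + b ∈ supClosure s})
      (fun b hb => subset_supClosure (hs (add_mem_add ha hb)))
      fun b hb c hc => by
        simpa only [mem_ofPred_eq, add_sup] using supClosed_supClosure hb hc
  have hright : ∀ b ∈ supClosure s, ∀ a ∈ supClosure s, a + b ∈ supClosure s := fun b hb =>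
    supClosure_min (t := {a | a + b ∈ supClosure s}) (fun a ha => hleft a ha b hb)
      fun a ha c hc => by
        simpa only [mem_ofPred_eq, sup_add] using supClosed_supClosure ha hc
  rintro _ ⟨a, ha, b, hb, rfl⟩
  exact hright b hb a ha

theorem isSublattice_sub_self (hsup : SupClosed M) (hadd : M + M ⊆ M) : IsSublattice (M - M) := by
  constructor
  · rintro _ ⟨a, ha, b, hb, rfl⟩ _ ⟨c, hc, e, he, rfl⟩
    refine ⟨(a + e) ⊔ (c + b), hsup (hadd (add_mem_add ha he)) (hadd (add_mem_add hc hb)),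
      b + e, hadd (add_mem_add hb he), ?_⟩
    simp only [sup_sub]
    congr 1 <;> abel
  · rintro _ ⟨a, ha, b, hb, rfl⟩ _ ⟨c, hc, e, he, rfl⟩
    refine ⟨a + c, hadd (add_mem_add ha hc), (b + c) ⊔ (e + a),
      hsup (hadd (add_mem_add hb hc)) (hadd (add_mem_add he ha)), ?_⟩
    simp only [sub_sup]
    congr 1 <;> abel

end LatticeClosure

section ConvexHull

variable {𝕜 V : Type*} [Field 𝕜] [LinearOrder 𝕜] [IsStrictOrderedRing 𝕜] [AddCommGroup V]
  [Module 𝕜 V]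

theorem isGreatest_convexHull {s : Set 𝕜} {m : 𝕜} (h : IsGreatest s m) :
    IsGreatest (convexHull 𝕜 s) m :=
  ⟨subset_convexHull 𝕜 s h.1, fun _ hx => convexHull_min h.2 (convex_Iic m) hx⟩

theorem mem_convexHull_face {K : Set V} {φ : V →ₗ[𝕜] 𝕜} {c : 𝕜} (hK : ∀ q ∈ K, c ≤ φ q) {p : V}
    (hp : p ∈ convexHull 𝕜 K) (hpc : φ p = c) : p ∈ convexHull 𝕜 {q ∈ K | φ q = c} := by
  suffices h : convexHull 𝕜 K ⊆ {p | c ≤ φ p ∧ (φ p = c → p ∈ convexHull 𝕜 {q ∈ K | φ q = c})} from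
    (h hp).2 hpc
  refine convexHull_min (fun q hq => ⟨hK q hq, fun hqc => subset_convexHull 𝕜 _ ⟨hq, hqc⟩⟩) ?_
  refine convex_iff_forall_pos.2 fun p hp q hq a b ha hb hab => ?_
  simp only [mem_ofPred_eq, map_add, map_smul, smul_eq_mul]
  have hc : a * c + b * c = c := by rw [← add_mul, hab, one_mul]
  have hac := mul_le_mul_of_nonneg_left hp.1 ha.le
  have hbc := mul_le_mul_of_nonneg_left hq.1 hb.le
  refine ⟨by linarith, fun heq => convex_convexHull 𝕜 _ (hp.2 ?_) (hq.2 ?_) ha.le hb.le hab⟩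
  · exact mul_left_cancel₀ ha.ne' (by linarith)
  · exact mul_left_cancel₀ hb.ne' (by linarith)

theorem exists_pos_le_norm_of_zero_notMem_convexHull {F : Type*} [NormedAddCommGroup F]
    [NormedSpace ℝ F] {s : Set F} (hs : s.Finite) :
    ∃ c > 0, ∀ T ⊆ s, (0 : F) ∉ convexHull ℝ T → ∀ v ∈ convexHull ℝ T, c ≤ ‖v‖ := by
  have h : ∀ᶠ c in 𝓝[>] (0 : ℝ), ∀ T ∈ 𝒫 s,
      (0 : F) ∉ convexHull ℝ T → ∀ v ∈ convexHull ℝ T, c ≤ ‖v‖ := by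
    refine (eventually_all_finite hs.powerset).2 fun T hT =>
      eventually_imp_distrib_left.2 fun h0 => ?_
    have hclosed : IsClosed (convexHull ℝ T) := (hs.subset hT).isClosed_convexHull ℝ
    obtain ⟨ε, hε, hball⟩ := Metric.mem_nhds_iff.1 (hclosed.isOpen_compl.mem_nhds h0)
    filter_upwards [Ioo_mem_nhdsGT hε] with c hc v hv
    by_contra! hlt
    exact hball (mem_ball_zero_iff.2 (hlt.trans hc.2)) hv
  obtain ⟨c, h, hc⟩ := (h.and self_mem_nhdsWithin).exists
  exact ⟨c, hc, h⟩

end ConvexHull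

section LeastNorm

variable {F : Type*} [NormedAddCommGroup F] [InnerProductSpace ℝ F]

theorem norm_sq_le_inner_of_isMinOn_norm {C : Set F} (hC : Convex ℝ C) {p : F} (hp : p ∈ C)
    (hmin : IsMinOn norm C p) {q : F} (hq : q ∈ C) : ‖p‖ ^ 2 ≤ inner ℝ p q := by
  have : Nonempty C := ⟨⟨p, hp⟩⟩
  have hinf : ‖0 - p‖ = ⨅ w : C, ‖0 - (w : F)‖ := by
    simp only [zero_sub, norm_neg]
    exact le_antisymm (le_ciInf fun w => hmin w.2)
      (ciInf_le ⟨0, by rintro _ ⟨w, rfl⟩; positivity⟩ (⟨p, hp⟩ : C))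
  have h := (norm_eq_iInf_iff_real_inner_le_zero hC hp).1 hinf q hq
  rw [zero_sub, inner_neg_left, inner_sub_right, real_inner_self_eq_norm_sq] at h
  linarith

-- Along `-t • p`, with `p` the element of least norm of the hull, each affine function decreases
-- at rate at least `‖p‖ ^ 2`, so a lower bound forces `p = 0`.
theorem zero_mem_convexHull_of_forall_exists_le {ι : Type*} [Finite ι] {α : ι → ℝ} {u : ι → F}
    {m : ℝ} (h : ∀ y, ∃ i, m ≤ α i + inner ℝ (u i) y) : (0 : F) ∈ convexHull ℝ (range u) := by
  obtain ⟨i₀, -⟩ := h 0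
  obtain ⟨p, hp, hmin⟩ := ((finite_range u).isCompact_convexHull (𝕜 := ℝ)).exists_isMinOn
    ⟨u i₀, subset_convexHull ℝ _ (mem_range_self i₀)⟩ continuous_norm.continuousOn
  suffices hp0 : p = 0 from hp0 ▸ hp
  by_contra hne
  have hrate : ∀ i, 0 < inner ℝ (u i) p := fun i => by
    rw [real_inner_comm]
    exact (pow_pos (norm_pos_iff.2 hne) 2).trans_le (norm_sq_le_inner_of_isMinOn_norm
      (convex_convexHull ℝ _) hp hmin (subset_convexHull ℝ _ (mem_range_self i)))
  have hlt : ∀ᶠ t : ℝ in atTop, ∀ i, α i + t * -inner ℝ (u i) p < m := eventually_all.2 fun i =>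
    (tendsto_atBot_add_const_left _ _ (tendsto_id.atTop_mul_const_of_neg
      (neg_neg_of_pos (hrate i)))).eventually_lt_atBot m
  obtain ⟨t, ht⟩ := hlt.exists
  obtain ⟨i, hi⟩ := h (t • -p)
  rw [inner_smul_right, inner_neg_right] at hi
  exact (ht i).not_ge hi

end LeastNorm

theorem inv_fst_mul_norm_sq_le {F : Type*} [NormedAddCommGroup F] {p : WithLp 2 (ℝ × F)}
    (hneg : p.fst < 0) : p.fst⁻¹ * ‖p‖ ^ 2 ≤ -‖p.snd‖ := by
  rw [WithLp.prod_norm_sq_eq_of_L2, Real.norm_eq_abs, sq_abs, inv_mul_eq_div,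
    div_le_iff_of_neg hneg]
  nlinarith [norm_nonneg p.snd]

section AffineFunctions

variable {F : Type*} [NormedAddCommGroup F] [InnerProductSpace ℝ F]

/-- The homogeneous coordinates `(1, y)` of a point `y`. Pairing with them turns the pair `(a, v)`
into the value at `y` of the affine function `a + ⟨v, ·⟩`. -/
def homogenize (y : F) : WithLp 2 (ℝ × F) := WithLp.toLp 2 (1, y)

theorem inner_homogenize (y : F) (q : WithLp 2 (ℝ × F)) :
    inner ℝ (homogenize y) q = q.fst + inner ℝ q.snd y := by
  simp [homogenize, WithLp.prod_inner_apply, real_inner_comm]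

theorem inner_homogenize_of_snd_eq_zero {q : WithLp 2 (ℝ × F)} (hq : q.snd = 0) (y : F) :
    inner ℝ (homogenize y) q = q.fst := by
  rw [inner_homogenize, hq, inner_zero_left, add_zero]

theorem inner_of_snd_eq_zero {q : WithLp 2 (ℝ × F)} (hq : q.snd = 0) (p : WithLp 2 (ℝ × F)) :
    inner ℝ p q = p.fst * q.fst := by
  simp [WithLp.prod_inner_apply, hq, mul_comm]

theorem homogenize_inv_fst_smul_snd {p : WithLp 2 (ℝ × F)} (hp : p.fst ≠ 0) :
    homogenize (p.fst⁻¹ • p.snd) = p.fst⁻¹ • p :=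
  WithLp.ofLp_injective 2 (Prod.ext (inv_mul_cancel₀ hp).symm rfl)

section LeastNorm

variable {C : Set (WithLp 2 (ℝ × F))} {p : WithLp 2 (ℝ × F)}

theorem isGreatest_inner_homogenize_inv_fst_smul_snd (hC : Convex ℝ C) (hp : p ∈ C)
    (hmin : IsMinOn norm C p) (hneg : p.fst < 0) :
    IsGreatest (inner ℝ (homogenize (p.fst⁻¹ • p.snd)) '' C) (p.fst⁻¹ * ‖p‖ ^ 2) := by
  simp only [homogenize_inv_fst_smul_snd hneg.ne, inner_smul_left_eq_smul, smul_eq_mul]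
  refine ⟨⟨p, hp, by simp⟩, ?_⟩
  rintro _ ⟨q, hq, rfl⟩
  exact mul_le_mul_of_nonpos_left (norm_sq_le_inner_of_isMinOn_norm hC hp hmin hq)
    (inv_nonpos.2 hneg.le)

theorem exists_snd_eq_zero_fst_nonneg (hC : Convex ℝ C) (hp : p ∈ C) (hmin : IsMinOn norm C p)
    (hpos : 0 ≤ p.fst) {q : WithLp 2 (ℝ × F)} (hq : q ∈ C) (hq0 : q.snd = 0) :
    ∃ r ∈ C, r.snd = 0 ∧ 0 ≤ r.fst := by
  rcases le_or_gt 0 q.fst with hnonneg | hlt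
  · exact ⟨q, hq, hq0, hnonneg⟩
  · have hle := norm_sq_le_inner_of_isMinOn_norm hC hp hmin hq
    rw [inner_of_snd_eq_zero hq0] at hle
    have hp0 : p = 0 := by
      have : ‖p‖ ^ 2 ≤ 0 := hle.trans (mul_nonpos_of_nonneg_of_nonpos hpos hlt.le)
      simpa using this
    exact ⟨p, hp, by simp [hp0], hpos⟩

end LeastNorm

theorem exists_subset_slopes_of_norm_sq_le_inner {K : Set (WithLp 2 (ℝ × F))}
    {p : WithLp 2 (ℝ × F)} (hp : p ∈ convexHull ℝ K) (hK : ∀ q ∈ K, ‖p‖ ^ 2 ≤ inner ℝ p q) :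
    ∃ T ⊆ WithLp.snd '' K, p.snd ∈ convexHull ℝ T ∧
      (0 ∈ convexHull ℝ T → ∃ q ∈ convexHull ℝ K, q.snd = 0 ∧ inner ℝ p q = ‖p‖ ^ 2) := by
  set face := {q ∈ K | innerₗ _ p q = ‖p‖ ^ 2}
  have hface : p ∈ convexHull ℝ face :=
    mem_convexHull_face hK hp (real_inner_self_eq_norm_sq p)
  have hsnd : convexHull ℝ (WithLp.snd '' face) = WithLp.snd '' convexHull ℝ face :=
    ((WithLp.sndₗ 2 ℝ ℝ F).image_convexHull face).symm
  refine ⟨WithLp.snd '' face, image_mono (sep_subset _ _), ?_, ?_⟩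
  · rw [hsnd]
    exact mem_image_of_mem _ hface
  · rw [hsnd]
    rintro ⟨q, hq, hq0⟩
    refine ⟨q, convexHull_mono (sep_subset _ _) hq, hq0, ?_⟩
    exact convexHull_min (fun q hq => hq.2) (convex_hyperplane (innerₗ _ p).isLinear _) hq

variable (F) in
/-- The affine functions `a + ⟨v, ·⟩` on `F`. -/
def affineFunctions : Set (F → ℝ) :=
  range fun (q : WithLp 2 (ℝ × F)) y => inner ℝ (homogenize y) q

theorem affineFunctions_add_subset :
    affineFunctions F + affineFunctions F ⊆ affineFunctions F := by
  rintro _ ⟨_, ⟨q, rfl⟩, _, ⟨r, rfl⟩, rfl⟩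
  exact ⟨q + r, funext fun y => inner_add_right _ _ _⟩

theorem affineMap_mem_affineFunctions [FiniteDimensional ℝ F] (g : F →ᵃ[ℝ] ℝ) :
    (g : F → ℝ) ∈ affineFunctions F := by
  have := FiniteDimensional.complete ℝ F
  refine ⟨WithLp.toLp 2
    (g 0, (InnerProductSpace.toDual ℝ F).symm (LinearMap.toContinuousLinearMap g.linear)), ?_⟩
  funext y
  beta_reduce
  rw [inner_homogenize, WithLp.toLp_fst, WithLp.toLp_snd, InnerProductSpace.toDual_symm_apply,
    LinearMap.coe_toContinuousLinearMap', congrFun g.decomp y, Pi.add_apply, add_comm]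

theorem latticeClosure_affineFunctions_subset :
    latticeClosure (affineFunctions F) ⊆
      supClosure (affineFunctions F) - supClosure (affineFunctions F) := by
  refine latticeClosure_min (fun g hg => ?_) (isSublattice_sub_self supClosed_supClosure
    (supClosure_add_subset affineFunctions_add_subset))
  exact ⟨g, subset_supClosure hg, 0, subset_supClosure ⟨0, by simp; rfl⟩, sub_zero g⟩

end AffineFunctions

theorem exists_isGreatest_of_mem_supClosure {X α : Type*} [LinearOrder α] {s : Set (X → α)}
    {P : X → α} (hP : P ∈ supClosure s) :
    ∃ (n : ℕ) (g : Fin n → X → α), 0 < n ∧ (∀ i, g i ∈ s) ∧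
      ∀ x, IsGreatest (range fun i => g i x) (P x) := by
  obtain ⟨t, ht, hts, rfl⟩ := hP
  refine ⟨t.card, fun i => t.equivFin.symm i, ht.card_pos, fun i => hts (t.equivFin.symm i).2,
    fun x => ⟨?_, ?_⟩⟩
  · obtain ⟨g, hg, hgx⟩ := Finset.exists_mem_eq_sup' ht fun g : X → α => g x
    exact ⟨t.equivFin ⟨g, hg⟩, by simpa [Finset.sup'_apply] using hgx.symm⟩
  · rintro _ ⟨i, rfl⟩
    exact Finset.le_sup' id (t.equivFin.symm i).2 x

namespace DCData

variable {d : ℕ} (D : DCData d)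

theorem isGreatest_convexPart (x : E d) :
    IsGreatest (range fun i => D.a i + inner ℝ (D.v i) x) (D.convexPart x) := by
  refine ⟨?_, ?_⟩
  · obtain ⟨i, -, hi⟩ := Finset.exists_mem_eq_sup' D.univ_nonempty_I
      fun i => D.a i + inner ℝ (D.v i) x
    exact ⟨i, hi.symm⟩
  · rintro _ ⟨i, rfl⟩
    exact Finset.le_sup' (fun i => D.a i + inner ℝ (D.v i) x) (Finset.mem_univ i)

theorem isLeast_concavePart (x : E d) :
    IsLeast (range fun j => D.b j + inner ℝ (D.w j) x) (D.concavePart x) := by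
  refine ⟨?_, ?_⟩
  · obtain ⟨j, -, hj⟩ := Finset.exists_mem_eq_inf' D.univ_nonempty_J
      fun j => D.b j + inner ℝ (D.w j) x
    exact ⟨j, hj.symm⟩
  · rintro _ ⟨j, rfl⟩
    exact Finset.inf'_le (fun j => D.b j + inner ℝ (D.w j) x) (Finset.mem_univ j)

end DCData

section Representation

variable {d : ℕ} {f : E d → ℝ}

theorem exists_represents_of_mem_sub
    (hf : f ∈ supClosure (affineFunctions (E d)) - supClosure (affineFunctions (E d))) :
    ∃ D : DCData d, D.Represents f := by
  obtain ⟨P, hP, Q, hQ, rfl⟩ := hf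
  obtain ⟨l, g, hl, hg, hPg⟩ := exists_isGreatest_of_mem_supClosure hP
  obtain ⟨s, h, hs, hh, hQh⟩ := exists_isGreatest_of_mem_supClosure hQ
  choose p hp using hg
  choose q hq using hh
  let D : DCData d := ⟨l, s, hl, hs, fun i => (p i).fst, fun i => (p i).snd,
    fun j => -(q j).fst, fun j => -(q j).snd⟩
  refine ⟨D, fun x => ?_⟩
  have hconvex : IsGreatest (range fun i => D.a i + inner ℝ (D.v i) x) (P x) := by
    simpa only [← hp, inner_homogenize] using hPg x
  have hconcave : IsLeast (range fun j => D.b j + inner ℝ (D.w j) x) (-Q x) := by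
    have hneg := Antitone.map_isGreatest (fun _ _ => neg_le_neg) (hQh x)
    simpa only [← hq, inner_homogenize, ← range_comp, Function.comp_def, neg_add,
      ← inner_neg_left] using hneg
  rw [(D.isGreatest_convexPart x).unique hconvex, (D.isLeast_concavePart x).unique hconcave]
  exact sub_eq_add_neg _ _

theorem IsPolyhedral.isClosed {Q : Set (E d)} (hQ : IsPolyhedral Q) : IsClosed Q := by
  obtain ⟨m, u, c, -, rfl⟩ := hQ
  simp only [ofPred_forall]
  exact isClosed_iInter fun i => isClosed_le (by fun_prop) continuous_const

theorem IsPiecewiseAffine.exists_isSelection (hf : IsPiecewiseAffine f) :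
    Continuous f ∧ ∃ (k : ℕ) (g : Fin k → E d →ᵃ[ℝ] ℝ), IsSelection f fun i => g i := by
  obtain ⟨k, Q, hQ, hfg⟩ := hf
  choose g hg using hfg
  refine ⟨(locallyFinite_of_finite Q).continuous hQ.cover (fun i => (hQ.polyhedral i).isClosed)
    fun i => (g i).continuous_of_finiteDimensional.continuousOn.congr (hg i), k, g, fun x => ?_⟩
  obtain ⟨i, hi⟩ := mem_iUnion.1 (hQ.cover ▸ mem_univ x : x ∈ ⋃ i, Q i)
  exact ⟨i, hg i hi⟩

theorem IsPiecewiseAffine.exists_represents (hf : IsPiecewiseAffine f) :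
    ∃ D : DCData d, D.Represents f := by
  obtain ⟨hcont, k, g, hsel⟩ := hf.exists_isSelection
  refine exists_represents_of_mem_sub (latticeClosure_affineFunctions_subset
    (latticeClosure_mono ?_ (hsel.mem_latticeClosure hcont)))
  rintro _ ⟨i, rfl⟩
  exact affineMap_mem_affineFunctions (g i)

end Representation

namespace DCData

section Codifferential

variable {d : ℕ} (D : DCData d)

/-- The convex function `max_i (a_i + ⟨v_i, x⟩) + b_j + ⟨w_j, x⟩`: the represented function is the
minimum of these over `j`. -/
noncomputable def piece (j : Fin D.s) (x : E d) : ℝ :=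
  D.convexPart x + (D.b j + inner ℝ (D.w j) x)

/-- The points whose convex hull is the codifferential `hypodiff x + z_j(x)` of `piece j`. -/
noncomputable def generator (j : Fin D.s) (x : E d) (i : Fin D.l) : EPlus d :=
  pair (D.a i - D.convexPart x + inner ℝ (D.v i) x) (D.v i) + D.z j x

/-- The trial point `x + a_j(x)⁻¹ v_j(x)`, a descent step when `a_j(x) < 0`. -/
noncomputable def trialPoint (j : Fin D.s) (x : E d) : E d :=
  x + (D.aj j x)⁻¹ • D.vj j x

theorem translate_hypodiff (j : Fin D.s) (x : E d) :
    translate (D.hypodiff x) (D.z j x) = convexHull ℝ (range (D.generator j x)) := by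
  have himage := AffineMap.image_convexHull (AffineMap.id ℝ (EPlus d) +
    AffineMap.const ℝ (EPlus d) (D.z j x) : EPlus d →ᵃ[ℝ] EPlus d)
    (range fun i => pair (D.a i - D.convexPart x + inner ℝ (D.v i) x) (D.v i))
  rwa [← range_comp] at himage

theorem convex_translate_hypodiff (j : Fin D.s) (x : E d) :
    Convex ℝ (translate (D.hypodiff x) (D.z j x)) :=
  D.translate_hypodiff j x ▸ convex_convexHull ℝ _

theorem snd_image_range_generator (j : Fin D.s) (x : E d) :
    WithLp.snd '' range (D.generator j x) = range fun i => D.v i + D.w j :=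
  (range_comp _ _).symm

theorem isMinOn_norm_nearest (j : Fin D.s) (x : E d) :
    IsMinOn norm (translate (D.hypodiff x) (D.z j x)) (D.nearest j x) :=
  (D.nearest_isLeastNorm j x).2

variable {D} {f : E d → ℝ}

theorem Represents.le_piece (hD : D.Represents f) (j : Fin D.s) (x : E d) : f x ≤ D.piece j x := by
  rw [hD, piece]
  gcongr
  exact (D.isLeast_concavePart x).2 (mem_range_self j)

theorem Represents.exists_eq_piece (hD : D.Represents f) (x : E d) : ∃ j, f x = D.piece j x := by
  obtain ⟨j, hj⟩ := (D.isLeast_concavePart x).1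
  exact ⟨j, by rw [hD, piece, ← hj]⟩

theorem Represents.inner_homogenize_generator (hD : D.Represents f) (j : Fin D.s) (x y : E d)
    (i : Fin D.l) : inner ℝ (homogenize y) (D.generator j x i) =
      D.a i + inner ℝ (D.v i) (x + y) + (D.b j + inner ℝ (D.w j) (x + y) - f x) := by
  rw [generator, inner_add_right, inner_homogenize, z, inner_homogenize, hD]
  simp only [WithLp.toLp_fst, WithLp.toLp_snd, inner_add_right]
  ring

theorem Represents.isGreatest_piece_sub (hD : D.Represents f) (j : Fin D.s) (x y : E d) :
    IsGreatest (inner ℝ (homogenize y) '' translate (D.hypodiff x) (D.z j x))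
      (D.piece j (x + y) - f x) := by
  have himage : inner ℝ (homogenize y) '' translate (D.hypodiff x) (D.z j x) =
      convexHull ℝ (range fun i => inner ℝ (homogenize y) (D.generator j x i)) := by
    rw [translate_hypodiff]
    exact ((innerₗ _ (homogenize y)).image_convexHull _).trans (by rw [← range_comp]; rfl)
  rw [himage, piece, add_sub_assoc]
  refine isGreatest_convexHull ?_
  simp only [hD.inner_homogenize_generator]
  have hshift := Monotone.map_isGreatest
    (add_left_mono (a := D.b j + inner ℝ (D.w j) (x + y) - f x)) (D.isGreatest_convexPart (x + y))
  rwa [← range_comp] at hshift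

theorem Represents.add_fst_le_piece (hD : D.Represents f) {j : Fin D.s} {x : E d} {q : EPlus d}
    (hq : q ∈ translate (D.hypodiff x) (D.z j x)) (hq0 : q.snd = 0) (y : E d) :
    f x + q.fst ≤ D.piece j y := by
  have hle := (hD.isGreatest_piece_sub j x (y - x)).2 (mem_image_of_mem _ hq)
  rw [inner_homogenize_of_snd_eq_zero hq0, add_sub_cancel] at hle
  linarith

end Codifferential

section Descent

variable {d : ℕ} {D : DCData d} {f : E d → ℝ} {j : Fin D.s} {x : E d}

theorem Represents.piece_trialPoint (hD : D.Represents f) (hneg : D.aj j x < 0) :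
    D.piece j (D.trialPoint j x) = f x + (D.aj j x)⁻¹ * ‖D.nearest j x‖ ^ 2 := by
  have hpiece := hD.isGreatest_piece_sub j x ((D.aj j x)⁻¹ • D.vj j x)
  have hnearest := isGreatest_inner_homogenize_inv_fst_smul_snd (D.convex_translate_hypodiff j x)
    (D.nearest_isLeastNorm j x).1 (D.isMinOn_norm_nearest j x) hneg
  exact eq_add_of_sub_eq' (hpiece.unique hnearest)

theorem Represents.piece_trialPoint_lt (hD : D.Represents f) (hneg : D.aj j x < 0) :
    D.piece j (D.trialPoint j x) < f x := by
  have hne : D.nearest j x ≠ 0 := fun h0 => hneg.ne (by rw [aj, h0]; rfl)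
  rw [hD.piece_trialPoint hneg]
  exact add_lt_of_neg_right _
    (mul_neg_of_neg_of_pos (inv_lt_zero.2 hneg) (pow_pos (norm_pos_iff.2 hne) 2))

theorem Represents.exists_decrease (hD : D.Represents f) (j : Fin D.s) :
    ∃ c > 0, ∀ x, D.aj j x < 0 → (∀ y, D.piece j (D.trialPoint j x) ≤ D.piece j y) ∨
      D.piece j (D.trialPoint j x) ≤ f x - c := by
  obtain ⟨c, hc, hcT⟩ :=
    exists_pos_le_norm_of_zero_notMem_convexHull (finite_range fun i => D.v i + D.w j)
  refine ⟨c, hc, fun x hneg => ?_⟩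
  have hp := (D.nearest_isLeastNorm j x).1
  have hinner : ∀ q ∈ translate (D.hypodiff x) (D.z j x),
      ‖D.nearest j x‖ ^ 2 ≤ inner ℝ (D.nearest j x) q := fun q hq =>
    norm_sq_le_inner_of_isMinOn_norm (D.convex_translate_hypodiff j x) hp
      (D.isMinOn_norm_nearest j x) hq
  rw [translate_hypodiff] at hp hinner
  obtain ⟨T, hT, hvT, hT0⟩ := exists_subset_slopes_of_norm_sq_le_inner hp
    fun q hq => hinner q (subset_convexHull ℝ _ hq)
  rw [snd_image_range_generator] at hT
  rw [hD.piece_trialPoint hneg]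
  by_cases h0 : (0 : E d) ∈ convexHull ℝ T
  · left
    obtain ⟨q, hq, hq0, hpq⟩ := hT0 h0
    rw [inner_of_snd_eq_zero hq0] at hpq
    rw [← hpq, ← aj, inv_mul_cancel_left₀ hneg.ne]
    exact hD.add_fst_le_piece (D.translate_hypodiff j x ▸ hq) hq0
  · right
    have hdrop := inv_fst_mul_norm_sq_le hneg
    have hslope := hcT T hT h0 _ hvT
    rw [aj]
    linarith

theorem Represents.bddBelow_piece (hD : D.Represents f) (hb : BddBelow (range f)) (j : Fin D.s) :
    BddBelow (range (D.piece j)) :=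
  hb.range_mono _ (hD.le_piece j)

theorem zero_mem_convexHull_slopes (hb : BddBelow (range (D.piece j))) :
    (0 : E d) ∈ convexHull ℝ (range fun i => D.v i + D.w j) := by
  obtain ⟨m, hm⟩ := hb
  refine zero_mem_convexHull_of_forall_exists_le (α := fun i => D.a i + D.b j) (m := m)
    fun y => ?_
  obtain ⟨i, hi⟩ := (D.isGreatest_convexPart y).1
  refine ⟨i, (hm (mem_range_self y)).trans_eq ?_⟩
  rw [piece, ← hi, inner_add_left]
  ring

theorem Represents.le_piece_of_aj_nonneg (hD : D.Represents f)
    (hb : BddBelow (range (D.piece j))) (hx : 0 ≤ D.aj j x) (y : E d) : f x ≤ D.piece j y := by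
  have h0 := zero_mem_convexHull_slopes hb
  rw [← D.snd_image_range_generator j x] at h0
  obtain ⟨q, hq, hq0⟩ := ((WithLp.sndₗ 2 ℝ ℝ (E d)).image_convexHull _).ge h0
  obtain ⟨r, hr, hr0, hr_nonneg⟩ := exists_snd_eq_zero_fst_nonneg
    (D.convex_translate_hypodiff j x) (D.nearest_isLeastNorm j x).1 (D.isMinOn_norm_nearest j x)
    hx (D.translate_hypodiff j x ▸ hq) hq0
  exact (le_add_of_nonneg_right hr_nonneg).trans (hD.add_fst_le_piece hr hr0 y)

theorem Represents.le_of_forall_aj_nonneg (hD : D.Represents f) (hb : BddBelow (range f))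
    (hx : ∀ j, 0 ≤ D.aj j x) (y : E d) : f x ≤ f y := by
  obtain ⟨j, hj⟩ := hD.exists_eq_piece y
  exact hj ▸ hD.le_piece_of_aj_nonneg (hD.bddBelow_piece hb j) (hx j) y

-- A trial point minimizing the `j`-th piece occurs at most once along the sequence, and each other
-- step with `a_j < 0` decreases `f` by a fixed amount.
theorem Represents.eventually_aj_nonneg (hD : D.Represents f) (hb : BddBelow (range f))
    {x : ℕ → E d} (hanti : Antitone fun n => f (x n)) (j : Fin D.s)
    (hstep : ∀ n, D.aj j (x n) < 0 → f (x (n + 1)) ≤ f (D.trialPoint j (x n))) :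
    ∀ᶠ n in atTop, 0 ≤ D.aj j (x n) := by
  obtain ⟨c, hc, hdec⟩ := hD.exists_decrease j
  have hstep_piece : ∀ n, D.aj j (x n) < 0 → f (x (n + 1)) ≤ D.piece j (D.trialPoint j (x n)) :=
    fun n hneg => (hstep n hneg).trans (hD.le_piece j _)
  by_cases hmin : ∃ n, D.aj j (x n) < 0 ∧ ∀ y, D.piece j (D.trialPoint j (x n)) ≤ D.piece j y
  · obtain ⟨n, hn, hmin⟩ := hmin
    filter_upwards [eventually_ge_atTop (n + 1)] with m hm
    by_contra! hneg
    exact ((hmin _).trans_lt (hD.piece_trialPoint_lt hneg)).not_ge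
      ((hanti hm).trans (hstep_piece n hn))
  · have hlim := tendsto_atTop_ciInf hanti (hb.mono (range_comp_subset_range x f))
    have hdiff : Tendsto (fun n => f (x n) - f (x (n + 1))) atTop (𝓝 0) := by
      simpa only [sub_self, Function.comp_apply] using
        hlim.sub (hlim.comp (tendsto_add_atTop_nat 1))
    filter_upwards [hdiff.eventually_lt_const hc] with n hn
    by_contra! hneg
    rcases hdec _ hneg with h | h
    · exact hmin ⟨n, hneg, h⟩
    · linarith [hstep_piece n hneg]

theorem Represents.findsGlobalMinimizer (hD : D.Represents f) (hb : BddBelow (range f))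
    {x : ℕ → E d} (hanti : Antitone fun n => f (x n))
    (hstep : ∀ n j, D.aj j (x n) < 0 → f (x (n + 1)) ≤ f (D.trialPoint j (x n))) :
    FindsGlobalMinimizer f D x := by
  obtain ⟨N, hN⟩ := eventually_atTop.1 (eventually_all.2 fun j =>
    hD.eventually_aj_nonneg hb hanti j fun n => hstep n j)
  exact ⟨N, fun n hn => ⟨hN n hn, hD.le_of_forall_aj_nonneg hb (hN n hn)⟩⟩

end Descent

section CodifferentialDescent

variable {d : ℕ} {D : DCData d} {f : E d → ℝ}

theorem Represents.continuous (hD : D.Represents f) : Continuous f := by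
  rw [show f = fun x => D.convexPart x + D.concavePart x from funext hD]
  unfold convexPart concavePart
  exact (Continuous.finset_sup'_apply _ fun i _ => by fun_prop).add
    (Continuous.finset_inf'_apply _ fun j _ => by fun_prop)

theorem Represents.isSelection (hD : D.Represents f) :
    IsSelection f fun (ij : Fin D.l × Fin D.s) x =>
      D.a ij.1 + inner ℝ (D.v ij.1) x + (D.b ij.2 + inner ℝ (D.w ij.2) x) := by
  intro x
  obtain ⟨i, hi⟩ := (D.isGreatest_convexPart x).1
  obtain ⟨j, hj⟩ := (D.isLeast_concavePart x).1
  exact ⟨(i, j), by rw [hD, ← hi, ← hj]⟩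

theorem Represents.exists_line_search (hD : D.Represents f) (hb : BddBelow (range f)) (x v : E d) :
    ∃ t : ℝ, 0 ≤ t ∧ ∀ s : ℝ, 0 ≤ s → f (x - t • v) ≤ f (x - s • v) := by
  have hray : IsSelection (fun t : ℝ => f (x - t • v)) fun (ij : Fin D.l × Fin D.s) t =>
      (D.a ij.1 + inner ℝ (D.v ij.1) x + (D.b ij.2 + inner ℝ (D.w ij.2) x)) +
        t * -(inner ℝ (D.v ij.1) v + inner ℝ (D.w ij.2) v) := by
    intro t
    obtain ⟨ij, hij⟩ := hD.isSelection (x - t • v)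
    refine ⟨ij, hij.trans ?_⟩
    simp only [inner_sub_right, inner_smul_right]
    ring
  obtain ⟨t, ht, htmin⟩ := hray.exists_isMinOn_of_affine (hD.continuous.comp (by fun_prop))
    isClosed_Ici nonempty_Ici
    (hb.mono ((image_subset_range _ _).trans (range_comp_subset_range (fun t => x - t • v) f)))
  exact ⟨t, ht, fun s hs => htmin hs⟩

theorem Represents.exists_isMCDStep (hD : D.Represents f) (hb : BddBelow (range f)) (x : E d) :
    ∃ y, IsMCDStep f (D.hypodiff x) (range fun j => D.z j x) ⊤ x y := by
  have hp : ∀ z ∈ range fun j => D.z j x, ∃ p, IsLeastNorm (translate (D.hypodiff x) z) p :=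
    forall_mem_range.2 fun j => D.exists_isLeastNorm j x
  choose! p hp using hp
  choose α hα using fun z => hD.exists_line_search hb x (p z).snd
  obtain ⟨z₀, hz₀, hmin⟩ := exists_min_image _ (fun z => f (x - α z • (p z).snd))
    (finite_range fun j => D.z j x) ⟨_, mem_range_self ⟨0, D.s_pos⟩⟩
  exact ⟨_, p, α, fun z hz _ => hp z hz, fun z _ _ => hα z, z₀, hz₀, le_top,
    fun z hz _ => hmin z hz, rfl⟩

theorem Represents.exists_isMCDSequence (hD : D.Represents f) (hb : BddBelow (range f))
    (x₀ : E d) : ∃ x : ℕ → E d, x 0 = x₀ ∧ IsMCDSequence f D x := by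
  choose next hnext using hD.exists_isMCDStep hb
  refine ⟨fun n => next^[n] x₀, rfl, fun n => ?_⟩
  simp only [Function.iterate_succ_apply']
  exact hnext _

theorem le_of_isMCDStep {x y : E d}
    (h : IsMCDStep f (D.hypodiff x) (range fun j => D.z j x) ⊤ x y) : f y ≤ f x := by
  obtain ⟨p, α, -, hα, z₀, hz₀, hz₀_le, -, rfl⟩ := h
  simpa only [zero_smul, sub_zero] using (hα z₀ hz₀ hz₀_le).2 0 le_rfl

-- The trial point lies on the ray searched for `z_j(x)`, since `-a_j(x)⁻¹ ≥ 0`.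
theorem le_trialPoint_of_isMCDStep {x y : E d}
    (h : IsMCDStep f (D.hypodiff x) (range fun j => D.z j x) ⊤ x y) {j : Fin D.s}
    (hneg : D.aj j x < 0) : f y ≤ f (D.trialPoint j x) := by
  obtain ⟨p, α, hp, hα, z₀, -, -, hmin, rfl⟩ := h
  have hz : D.z j x ∈ range fun j => D.z j x := mem_range_self j
  have hsearch := (hα _ hz le_top).2 (-(D.aj j x)⁻¹) (neg_nonneg.2 (inv_nonpos.2 hneg.le))
  refine (hmin _ hz le_top).trans (hsearch.trans_eq ?_)
  rw [D.eq_nearest j x _ (hp _ hz le_top), neg_smul, sub_neg_eq_add, trialPoint, vj]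

theorem Represents.findsGlobalMinimizer_of_isMCDSequence (hD : D.Represents f)
    (hb : BddBelow (range f)) {x : ℕ → E d} (hx : IsMCDSequence f D x) :
    FindsGlobalMinimizer f D x :=
  hD.findsGlobalMinimizer hb (antitone_nat_of_succ_le fun n => le_of_isMCDStep (hx n))
    fun n _ hneg => le_trialPoint_of_isMCDStep (hx n) hneg

theorem Represents.exists_forall_le (hD : D.Represents f) (hb : BddBelow (range f)) :
    ∃ x, ∀ y, f x ≤ f y := by
  obtain ⟨x, -, hx⟩ := hD.exists_isMCDSequence hb 0
  obtain ⟨N, hN⟩ := hD.findsGlobalMinimizer_of_isMCDSequence hb hx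
  exact ⟨x N, (hN N le_rfl).2⟩

end CodifferentialDescent

end DCData

end PiecewiseAffine

open PiecewiseAffine in
theorem mainTheorem4 {d : ℕ} (f : E d → ℝ) (hf : IsPiecewiseAffine f)
    (hbdd : BddBelow (Set.range f)) :
    (∃ D : DCData d, D.Represents f) ∧
    (∃ xmin, ∀ y, f xmin ≤ f y) ∧
    ∀ D : DCData d, D.Represents f →
      (∀ x : ℕ → E d,
        (∀ n, f (x (n + 1)) ≤ f (x n)) →
        (∀ n j, D.aj j (x n) < 0 →
          f (x (n + 1)) ≤ f (x n + (D.aj j (x n))⁻¹ • D.vj j (x n))) →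
        FindsGlobalMinimizer f D x) ∧
      (∀ x₀ : E d, ∃ x : ℕ → E d, x 0 = x₀ ∧ IsMCDSequence f D x) ∧
      (∀ x : ℕ → E d, IsMCDSequence f D x → FindsGlobalMinimizer f D x) := by
  obtain ⟨D₀, hD₀⟩ := hf.exists_represents
  refine ⟨⟨D₀, hD₀⟩, hD₀.exists_forall_le hbdd, fun D hD => ⟨fun x hanti hstep => ?_, ?_, ?_⟩⟩
  · exact hD.findsGlobalMinimizer hbdd (antitone_nat_of_succ_le hanti) hstep
  · exact hD.exists_isMCDSequence hbdd
  · exact fun x hx => hD.findsGlobalMinimizer_of_isMCDSequence hbdd hx
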